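/- Let $\Omega=\{0,1\}^{\mathbb N}$ be the Cantor space and, for a binary string $x$, let $[x]\subset\Omega$ be the set of infinite extensions of $x$; $\omega_{1\ldots n}$ is the initial segment of $\omega$ of length $n$, and $\log$ is the binary logarithm. A finite Borel measure $\mu$ on $\Omega$ is computable if some algorithm, given a string $x$ and a rational $\varepsilon>0$, returns a rational $\varepsilon$-approximation of $\mu([x])$. A basic function is a finitely supported function from binary strings to $\mathbb Q$. A function from binary strings to $\mathbb R$ is lower semicomputable if it is the pointwise limit of an increasing computable sequence of basic functions. A continuous lower semicomputable semimeasure is a lower semicomputable function $a\ge 0$ on binary strings with $\sum_{x\in S}a(x)\le 1$ for every prefix-free set $S$ of strings. Let $\mathbf a=\sum_{j\ge 0}2^{-j-1}a_j$ be the continuous a priori probability, where $(a_j)_{j\ge0}$ is the following effective enumeration of all continuous lower semicomputable semimeasures: $a_j$ is the supremum ($0$ if there is none), over $t$ such that the $j$-th program halts on inputs $0,\ldots,t$ and outputs codes of an increasing sequence of basic functions $f_0\le\dots\le f_t$ whose positive parts have sum at most $1$ over every prefix-free set, of the positive part of $f_t$. Put $$\mathbf d^{\limsup A}_\mu(\omega)=\limsup_{n\to\infty}\bigl\{-\log\mu([\omega_{1\ldots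 n}])-KA(\omega_{1\ldots n})\bigr\},\qquad KA(x)=-\log\mathbf a(x),$$ with values in $[-\infty,\infty]$. Corollary. Let $\mu$ be a computable measure. Then the function $2^{\mathbf d^{\limsup A}_\mu}:\Omega\to[0,\infty]$ is integrable with respect to $\mu$ (that is, $\mu$-measurable with $\int_\Omega 2^{\mathbf d^{\limsup A}_\mu}\,d\mu<\infty$). The same holds if $\mathbf a$ is replaced in the definition by any other continuous lower semicomputable semimeasure that is largest up to a multiplicative constant among all of them. -/

import Mathlib

open MeasureTheory Filter Topology
open scoped ENNReal

namespace Deficiency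

noncomputable section

/-! ### Binary strings, the Cantor space, intervals -/

/-- The Cantor space `Ω` of infinite binary sequences, with the product (= Borel) σ-algebra. -/
abbrev Cantor : Type := ℕ → Bool

/-- The initial segment of length `n` of the sequence `ω`. -/
def initSeg (ω : Cantor) (n : ℕ) : List Bool := (List.range n).map ω

/-- The interval `[x]`: all infinite extensions of the string `x`. -/
def interval (x : List Bool) : Set Cantor := {ω | initSeg ω x.length = x}

/-- A set of strings is prefix-free if no element is a proper prefix of another one. -/
def PrefixFree (S : Set (List Bool)) : Prop :=
  ∀ x ∈ S, ∀ y ∈ S, x <+: y → x = y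

/-! ### Rationals as constructive objects, computable measures -/

/-- Codes of rational numbers by triples of natural numbers. -/
abbrev RatCode : Type := ℕ × ℕ × ℕ

/-- The triple `(p, q, r)` codes the rational number `(p - q) / (r + 1)`. -/
def RatCode.val (c : RatCode) : ℚ := ((c.1 : ℚ) - (c.2.1 : ℚ)) / ((c.2.2 : ℚ) + 1)

/-- `μ` is computable: an algorithm that, given a string `x` and a rational `ε > 0`, returns a
rational `ε`-approximation of `μ [x]`. -/
def IsComputableMeasure (μ : Measure Cantor) : Prop :=
  ∃ g : List Bool → RatCode → RatCode, Computable₂ g ∧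
    ∀ (x : List Bool) (ε : RatCode), 0 < ε.val →
      |(μ (interval x)).toReal - ((g x ε).val : ℝ)| ≤ (ε.val : ℝ)

/-! ### Lower semicomputable functions and semimeasures on strings -/

/-- Codes of basic functions (finitely supported functions from strings to `ℚ`): finite lists
of pairs (string, rational). -/
abbrev BasicCode : Type := List (List Bool × RatCode)

/-- The basic function coded by the list `b`; its value at `x` is the sum of the rationals that
`b` attaches to `x`. -/
def BasicCode.val (b : BasicCode) (x : List Bool) : ℚ :=
  ((b.filter (fun e => e.1 = x)).map (fun e => e.2.val)).sum

/-- `f` is lower semicomputable: the pointwise limit of an increasing computable sequence of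
basic functions. -/
def LowerSemicomputable (f : List Bool → ℝ) : Prop :=
  ∃ F : ℕ → BasicCode, Computable F ∧
    (∀ x, Monotone (fun n => (F n).val x)) ∧
    ∀ x, Tendsto (fun n => ((F n).val x : ℝ)) atTop (𝓝 (f x))

/-- Continuous lower semicomputable semimeasures. -/
structure IsSemimeasure (a : List Bool → ℝ) : Prop where
  nonneg : ∀ x, 0 ≤ a x
  sum_le_one : ∀ S : Set (List Bool), PrefixFree S → ∑' x : S, ENNReal.ofReal (a x) ≤ 1
  lowerSemicomputable : LowerSemicomputable a

/-- `a` is a largest (up to a multiplicative constant) continuous lower semicomputable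
semimeasure. -/
def IsMaximalSemimeasure (a : List Bool → ℝ) : Prop :=
  IsSemimeasure a ∧
    ∀ b : List Bool → ℝ, IsSemimeasure b → ∃ c : ℝ, 0 < c ∧ ∀ x, b x ≤ c * a x

/-! ### The continuous a priori probability -/

/-- The machine with program `c` halts on the inputs `0, …, t` with outputs that code an
increasing sequence of basic functions whose positive parts have sum at most `1` over each
prefix-free set, and the last of these outputs is `b`. -/
def Accepted (c : Nat.Partrec.Code) (t : ℕ) (b : BasicCode) : Prop :=
  ∃ F : ℕ → BasicCode,
    (∀ n ≤ t, Encodable.encode (F n) ∈ c.eval n) ∧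
    (∀ n < t, ∀ x, (F n).val x ≤ (F (n + 1)).val x) ∧
    (∀ n ≤ t, ∀ S : Set (List Bool), PrefixFree S →
      ∑' x : S, ENNReal.ofReal ((F n).val x : ℝ) ≤ 1) ∧
    F t = b

/-- The semimeasure enumerated by the program `c`: the supremum of the approximations that
`c` produces as long as its outputs are acceptable. If `c` computes an increasing sequence of
basic functions with limit a continuous semimeasure, this is that limit, so that every
continuous lower semicomputable semimeasure appears. -/
def enumSemimeasure (c : Nat.Partrec.Code) (x : List Bool) : ℝ≥0∞ :=
  ⨆ (t : ℕ) (b : BasicCode) (_ : Accepted c t b), ENNReal.ofReal (b.val x : ℝ)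

/-- The continuous a priori probability: the weighted sum of all continuous lower
semicomputable semimeasures. -/
def aPriori (x : List Bool) : ℝ :=
  (∑' j : ℕ, (2⁻¹ : ℝ≥0∞) ^ (j + 1) *
    enumSemimeasure (Denumerable.ofNat Nat.Partrec.Code j) x).toReal

/-! ### A priori complexity and deficiency -/

/-- Binary logarithm on `[0, ∞]`, with `log 0 = -∞` and `log ∞ = ∞`. -/
def log2 (x : ℝ≥0∞) : EReal := ENNReal.log x / ((Real.log 2 : ℝ) : EReal)

/-- `y ↦ 2 ^ y` on `[-∞, ∞]`, with `2 ^ (-∞) = 0` and `2 ^ ∞ = ∞`. -/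
def exp2 (y : EReal) : ℝ≥0∞ := EReal.exp (y * ((Real.log 2 : ℝ) : EReal))

/-- The a priori complexity `KA(x) = - log a(x)` for the a priori probability `a`. -/
def KA (a : List Bool → ℝ) (x : List Bool) : EReal := -log2 (ENNReal.ofReal (a x))

/-- The limsup a priori deficiency: `limsup_n (- log μ [ω₁…ωₙ] - KA (ω₁…ωₙ))`. -/
def dLimsup (a : List Bool → ℝ) (μ : Measure Cantor) (ω : Cantor) : EReal :=
  limsup (fun n : ℕ => -log2 (μ (interval (initSeg ω n))) - KA a (initSeg ω n)) atTop

end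

end Deficiency

/-! Exponentiating turns the deficiency into the limit superior of the ratios `a x / μ [x]` along
the prefixes of `ω`. If `a` satisfied `a (x0) + a (x1) ≤ a x`, these ratios would form a nonnegative
supermartingale. A bound on sums over prefix-free sets does not give this inequality, so `a` is
replaced by its `envelope`, a superadditive majorant whose value at the root is still at most 1
(`envelope_append_add_le`, `envelope_le`). For superadditive `b`, Doob's theorem makes the ratios
converge almost everywhere (`ae_limsup_ratio_eq_liminf`), so the limit superior equals the limit
inferior, whose integral Fatou's lemma bounds by `b []`. For `aPriori` it remains to check the
prefix-free bound (`tsum_aPriori_le_one`). -/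

namespace Deficiency

/-! ### Powers of two and the deficiency as a limit superior of ratios -/

/-- `exp2` as an order isomorphism. -/
noncomputable def exp2OrderIso : EReal ≃o ℝ≥0∞ :=
  EReal.expOrderIso.trans (ENNReal.orderIsoRpow (Real.log 2) (Real.log_pos one_lt_two))

lemma exp2_eq_rpow (y : EReal) : exp2 y = EReal.exp y ^ Real.log 2 := EReal.exp_mul y _

lemma exp2OrderIso_apply (y : EReal) : exp2OrderIso y = exp2 y := (exp2_eq_rpow y).symm

lemma exp2_add (x y : EReal) : exp2 (x + y) = exp2 x * exp2 y := by
  simp only [exp2_eq_rpow, EReal.exp_add]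
  exact ENNReal.mul_rpow_of_nonneg _ _ (Real.log_pos one_lt_two).le

lemma exp2_neg (x : EReal) : exp2 (-x) = (exp2 x)⁻¹ := by
  simp only [exp2_eq_rpow, EReal.exp_neg, ENNReal.inv_rpow]

lemma exp2_log2 (x : ℝ≥0∞) : exp2 (log2 x) = x := by
  have h0 : (Real.log 2 : EReal) ≠ 0 := by
    exact_mod_cast (Real.log_pos one_lt_two).ne'
  rw [exp2, log2, EReal.div_mul_cancel (EReal.coe_ne_bot _) (EReal.coe_ne_top _) h0,
    ENNReal.exp_log]

/-- No exceptional case arises: when `μ` and `a` both vanish, `⊤ + ⊥ = ⊥` in `EReal` matches `∞ * 0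
= 0` in `ℝ≥0∞`. -/
lemma exp2_dLimsup (a : List Bool → ℝ) (μ : Measure Cantor) (ω : Cantor) :
    exp2 (dLimsup a μ ω) =
      limsup (fun n => (μ (interval (initSeg ω n)))⁻¹ * ENNReal.ofReal (a (initSeg ω n)))
        atTop := by
  rw [dLimsup, ← exp2OrderIso_apply, OrderIso.limsup_apply]
  simp only [exp2OrderIso_apply, KA, sub_eq_add_neg, neg_neg, exp2_add, exp2_neg, exp2_log2]

/-! ### Initial segments and intervals -/

lemma length_initSeg (ω : Cantor) (n : ℕ) : (initSeg ω n).length = n := by simp [initSeg]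

lemma initSeg_succ (ω : Cantor) (n : ℕ) : initSeg ω (n + 1) = initSeg ω n ++ [ω n] := by
  simp [initSeg, List.range_succ]

lemma take_initSeg (ω : Cantor) {m n : ℕ} (h : m ≤ n) :
    (initSeg ω n).take m = initSeg ω m := by
  simp [initSeg, ← List.map_take, List.take_range, h]

lemma mem_interval_iff {x : List Bool} {ω : Cantor} :
    ω ∈ interval x ↔ initSeg ω x.length = x := Iff.rfl

lemma interval_eq_union (x : List Bool) :
    interval x = interval (x ++ [false]) ∪ interval (x ++ [true]) := by
  ext ω
  simp only [Set.mem_union, mem_interval_iff, List.length_append, List.length_singleton,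
    initSeg_succ]
  constructor
  · intro h
    cases hb : ω x.length <;> simp [h]
  · rintro (h | h) <;> exact (List.append_inj' h rfl).1

lemma disjoint_interval_append (x : List Bool) :
    Disjoint (interval (x ++ [false])) (interval (x ++ [true])) := by
  rw [Set.disjoint_left]
  intro ω h h'
  simp only [mem_interval_iff, List.length_append, List.length_singleton] at h h'
  have := h.symm.trans h'
  simp at this

lemma measurable_initSeg (n : ℕ) : Measurable[_, ⊤] (fun ω : Cantor => initSeg ω n) := by
  let _ : MeasurableSpace (List Bool) := ⊤
  have h : (fun ω : Cantor => initSeg ω n) =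
      (fun v : Fin n → Bool => List.ofFn v) ∘ (fun ω i => ω i) := by
    ext1 ω
    refine List.ext_getElem (by simp [initSeg]) ?_
    simp [initSeg]
  rw [h]
  exact (measurable_of_countable _).comp (by fun_prop)

lemma measurableSet_interval (x : List Bool) : MeasurableSet (interval x) :=
  measurable_initSeg x.length (t := {x}) trivial

/-- The filtration of the Cantor space by initial segments. -/
def initSegFiltration : Filtration ℕ (inferInstance : MeasurableSpace Cantor) where
  seq n := MeasurableSpace.comap (fun ω => initSeg ω n) ⊤
  mono' m n h := by
    rintro _ ⟨T, -, rfl⟩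
    refine ⟨{x | x.take m ∈ T}, trivial, ?_⟩
    ext ω
    simp [take_initSeg ω h]
  le' n := (measurable_initSeg n).comap_le

lemma measurable_comp_initSeg {β : Type*} [MeasurableSpace β] (g : List Bool → β) (n : ℕ) :
    Measurable[initSegFiltration n] (fun ω => g (initSeg ω n)) := by
  intro s _
  exact ⟨g ⁻¹' s, trivial, rfl⟩

/-! ### The superadditive envelope -/

/-- The supremum of the sums of `a` over prefix-free sets of extensions of `x`. -/
noncomputable def envelope (a : List Bool → ℝ≥0∞) (x : List Bool) : ℝ≥0∞ :=
  ⨆ (S : Set (List Bool)) (_ : PrefixFree S ∧ ∀ y ∈ S, x <+: y), ∑' y : S, a y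

lemma le_envelope (a : List Bool → ℝ≥0∞) (x : List Bool) : a x ≤ envelope a x := by
  refine le_iSup₂_of_le {x} ⟨?_, ?_⟩ ?_
  · rintro y rfl z rfl _; rfl
  · rintro y rfl; exact List.prefix_rfl
  · rw [tsum_singleton x a]

lemma envelope_le {a : List Bool → ℝ≥0∞} {c : ℝ≥0∞}
    (ha : ∀ S, PrefixFree S → ∑' y : S, a y ≤ c) (x : List Bool) : envelope a x ≤ c :=
  iSup₂_le fun S hS => ha S hS.1

/-- Extensions of `x0` and of `x1` are incomparable, so prefix-free sets chosen below the two
children have a disjoint, prefix-free union, which competes in the supremum at `x`. -/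
lemma envelope_append_add_le (a : List Bool → ℝ≥0∞) (x : List Bool) :
    envelope a (x ++ [false]) + envelope a (x ++ [true]) ≤ envelope a x := by
  have hne : ∀ z, ∃ S : Set (List Bool), PrefixFree S ∧ ∀ y ∈ S, z <+: y :=
    fun z => ⟨∅, by simp [PrefixFree], by simp⟩
  have hinc : ∀ {y : List Bool}, x ++ [false] <+: y → x ++ [true] <+: y → False := by
    intro y h h'
    have := (List.prefix_of_prefix_length_le h h' (by simp)).eq_of_length (by simp)
    simp at this
  refine ENNReal.biSup_add_biSup_le' (hne _) (hne _) fun S hS T hT => ?_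
  have hd : Disjoint S T := Set.disjoint_left.2 fun y hy hy' => hinc (hS.2 y hy) (hT.2 y hy')
  rw [← ENNReal.summable.tsum_union_disjoint hd ENNReal.summable]
  refine le_iSup₂_of_le (S ∪ T) ⟨?_, ?_⟩ le_rfl
  · rintro y (hy | hy) z (hz | hz) h
    · exact hS.1 y hy z hz h
    · exact (hinc ((hS.2 y hy).trans h) (hT.2 z hz)).elim
    · exact (hinc (hS.2 z hz) ((hT.2 y hy).trans h)).elim
    · exact hT.1 y hy z hz h
  · rintro y (hy | hy)
    · exact (List.prefix_append _ _).trans (hS.2 y hy)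
    · exact (List.prefix_append _ _).trans (hT.2 y hy)

/-! ### Ratios of a superadditive function to a measure -/

section Ratio

variable {μ : Measure Cantor} {b : List Bool → ℝ≥0∞}

/-- The ratio of `b` and `μ` on the initial segments of length `n`. -/
noncomputable def ratio (b : List Bool → ℝ≥0∞) (μ : Measure Cantor) (n : ℕ) (ω : Cantor) : ℝ≥0∞ :=
  (μ (interval (initSeg ω n)))⁻¹ * b (initSeg ω n)

lemma measurable_ratio_filtration (n : ℕ) : Measurable[initSegFiltration n] (ratio b μ n) :=
  measurable_comp_initSeg (fun x => (μ (interval x))⁻¹ * b x) n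

lemma measurable_ratio (n : ℕ) : Measurable (ratio b μ n) :=
  (measurable_ratio_filtration n).mono (initSegFiltration.le n) le_rfl

lemma setLIntegral_interval_ratio (x : List Bool) :
    ∫⁻ ω in interval x, ratio b μ x.length ω ∂μ = (μ (interval x))⁻¹ * b x * μ (interval x) := by
  rw [← setLIntegral_const]
  refine setLIntegral_congr_fun (measurableSet_interval x) fun ω hω => ?_
  rw [mem_interval_iff] at hω
  simp only [ratio, hω]

/-- Equality can fail only on a null interval, where the integral is zero although `b x` may be
positive. -/
lemma setLIntegral_interval_ratio_le (x : List Bool) :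
    ∫⁻ ω in interval x, ratio b μ x.length ω ∂μ ≤ b x := by
  rw [setLIntegral_interval_ratio, mul_right_comm]
  exact mul_le_of_le_one_left' (ENNReal.inv_mul_le_one _)

lemma setLIntegral_interval_ratio_succ_le [IsFiniteMeasure μ]
    (hb : ∀ x, b (x ++ [false]) + b (x ++ [true]) ≤ b x) (x : List Bool) :
    ∫⁻ ω in interval x, ratio b μ (x.length + 1) ω ∂μ ≤
      ∫⁻ ω in interval x, ratio b μ x.length ω ∂μ := by
  by_cases h0 : μ (interval x) = 0
  · rw [setLIntegral_measure_zero _ _ h0]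
    exact zero_le
  · calc
      _ = ∫⁻ ω in interval (x ++ [false]), ratio b μ (x ++ [false]).length ω ∂μ +
          ∫⁻ ω in interval (x ++ [true]), ratio b μ (x ++ [true]).length ω ∂μ := by
        rw [interval_eq_union x, lintegral_union (measurableSet_interval _)
          (disjoint_interval_append x)]
        simp
      _ ≤ b (x ++ [false]) + b (x ++ [true]) :=
        add_le_add (setLIntegral_interval_ratio_le _) (setLIntegral_interval_ratio_le _)
      _ ≤ b x := hb x
      _ = _ := by
        rw [setLIntegral_interval_ratio, mul_right_comm,
          ENNReal.inv_mul_cancel h0 (measure_ne_top _ _), one_mul]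

lemma setLIntegral_ratio_succ_le [IsFiniteMeasure μ]
    (hb : ∀ x, b (x ++ [false]) + b (x ++ [true]) ≤ b x) (n : ℕ) {s : Set Cantor}
    (hs : MeasurableSet[initSegFiltration n] s) :
    ∫⁻ ω in s, ratio b μ (n + 1) ω ∂μ ≤ ∫⁻ ω in s, ratio b μ n ω ∂μ := by
  obtain ⟨T, -, rfl⟩ := hs
  -- An event of level `n` is a disjoint union of intervals of length `n`, which reduces the claim
  -- to a single interval.
  have hT : (fun ω => initSeg ω n) ⁻¹' T = ⋃ x ∈ {x ∈ T | x.length = n}, interval x := by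
    ext ω
    simp only [Set.mem_preimage, Set.mem_iUnion, mem_interval_iff, Set.mem_ofPred_eq, exists_prop]
    constructor
    · exact fun h => ⟨_, ⟨h, length_initSeg ω n⟩, by rw [length_initSeg]⟩
    · rintro ⟨x, ⟨hx, rfl⟩, h⟩
      rwa [h]
  have hd : {x ∈ T | x.length = n}.PairwiseDisjoint interval := by
    rintro x ⟨-, hx⟩ y ⟨-, hy⟩ hxy
    refine Set.disjoint_left.2 fun ω h h' => hxy ?_
    rw [mem_interval_iff] at h h'
    rw [← h, ← h', hx, hy]
  rw [hT, lintegral_biUnion (Set.to_countable _) (fun x _ => measurableSet_interval x) hd,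
    lintegral_biUnion (Set.to_countable _) (fun x _ => measurableSet_interval x) hd]
  refine ENNReal.tsum_le_tsum ?_
  rintro ⟨x, -, rfl⟩
  exact setLIntegral_interval_ratio_succ_le hb x

lemma lintegral_ratio_le [IsFiniteMeasure μ]
    (hb : ∀ x, b (x ++ [false]) + b (x ++ [true]) ≤ b x) (n : ℕ) :
    ∫⁻ ω, ratio b μ n ω ∂μ ≤ b [] := by
  induction n with
  | zero =>
    have h : interval [] = Set.univ := Set.eq_univ_of_forall fun ω => rfl
    simpa [h] using setLIntegral_interval_ratio_le (μ := μ) (b := b) []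
  | succ n ih =>
    simpa using (setLIntegral_ratio_succ_le hb n MeasurableSet.univ).trans
      (by simpa using ih)

lemma supermartingale_toReal_ratio [IsFiniteMeasure μ]
    (hb : ∀ x, b (x ++ [false]) + b (x ++ [true]) ≤ b x) (h0 : b [] ≠ ∞) :
    Supermartingale (fun n ω => (ratio b μ n ω).toReal) initSegFiltration μ := by
  have hfin : ∀ n, ∫⁻ ω, ratio b μ n ω ∂μ ≠ ∞ := fun n =>
    ((lintegral_ratio_le hb n).trans_lt h0.lt_top).ne
  refine supermartingale_of_setIntegral_succ_le
    (fun n => (measurable_ratio_filtration n).ennreal_toReal.stronglyMeasurable)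
    (fun n => integrable_toReal_of_lintegral_ne_top (measurable_ratio n).aemeasurable (hfin n))
    fun n s hs => ?_
  have hae : ∀ m, ∀ᵐ ω ∂μ.restrict s, ratio b μ m ω < ∞ := fun m =>
    ae_restrict_of_ae (ae_lt_top (measurable_ratio m) (hfin m))
  rw [integral_toReal (measurable_ratio _).aemeasurable (hae _),
    integral_toReal (measurable_ratio _).aemeasurable (hae _)]
  refine ENNReal.toReal_mono ?_ (setLIntegral_ratio_succ_le hb n hs)
  exact ((setLIntegral_le_lintegral _ _).trans_lt (hfin n).lt_top).ne

/-- The ratio of a superadditive function and a finite measure converges almost everywhere. -/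
lemma ae_limsup_ratio_eq_liminf [IsFiniteMeasure μ]
    (hb : ∀ x, b (x ++ [false]) + b (x ++ [true]) ≤ b x) (h0 : b [] ≠ ∞) :
    ∀ᵐ ω ∂μ, limsup (fun n => ratio b μ n ω) atTop = liminf (fun n => ratio b μ n ω) atTop := by
  have hfin : ∀ n, ∫⁻ ω, ratio b μ n ω ∂μ ≠ ∞ := fun n =>
    ((lintegral_ratio_le hb n).trans_lt h0.lt_top).ne
  have hae : ∀ᵐ ω ∂μ, ∀ n, ratio b μ n ω < ∞ :=
    ae_all_iff.2 fun n => ae_lt_top (measurable_ratio n) (hfin n)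
  -- The convergence theorem is for submartingales, hence the negation and the limit `-c` below. As
  -- the ratios are nonnegative, their `L¹` norms are their integrals, bounded by `b []`.
  have hconv := (supermartingale_toReal_ratio (μ := μ) hb h0).neg.exists_ae_tendsto_of_bdd
    (R := (b []).toNNReal) fun n => by
      rw [ENNReal.coe_toNNReal h0, Pi.neg_apply, eLpNorm_neg, eLpNorm_one_eq_lintegral_enorm]
      refine (lintegral_mono fun ω => ?_).trans (lintegral_ratio_le (μ := μ) hb n)
      rw [Real.enorm_of_nonneg ENNReal.toReal_nonneg]
      exact ENNReal.ofReal_toReal_le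
  filter_upwards [hae, hconv] with ω hω ⟨c, hc⟩
  have hlim : Tendsto (fun n => ratio b μ n ω) atTop (𝓝 (ENNReal.ofReal (-c))) := by
    refine (ENNReal.tendsto_ofReal hc.neg).congr fun n => ?_
    simp [ENNReal.ofReal_toReal (hω n).ne]
  rw [hlim.limsup_eq, hlim.liminf_eq]

lemma lintegral_limsup_ratio_le [IsFiniteMeasure μ]
    (hb : ∀ x, b (x ++ [false]) + b (x ++ [true]) ≤ b x) (h0 : b [] ≠ ∞) :
    ∫⁻ ω, limsup (fun n => ratio b μ n ω) atTop ∂μ ≤ b [] := by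
  -- Fatou's lemma controls only the limit inferior; almost everywhere convergence transfers the
  -- bound to the limit superior.
  rw [lintegral_congr_ae (ae_limsup_ratio_eq_liminf hb h0)]
  refine (lintegral_liminf_le fun n => measurable_ratio n).trans ?_
  exact (liminf_le_liminf (.of_forall (lintegral_ratio_le hb))).trans_eq (liminf_const _)

end Ratio

lemma lintegral_limsup_ratio_le_one (μ : Measure Cantor) [IsFiniteMeasure μ]
    {a : List Bool → ℝ≥0∞} (ha : ∀ S, PrefixFree S → ∑' x : S, a x ≤ 1) :
    ∫⁻ ω, limsup (fun n => ratio a μ n ω) atTop ∂μ ≤ 1 := by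
  have h1 : envelope a [] ≤ 1 := envelope_le ha []
  refine (lintegral_mono fun ω => ?_).trans ((lintegral_limsup_ratio_le
    (envelope_append_add_le a) (h1.trans_lt ENNReal.one_lt_top).ne).trans h1)
  refine limsup_le_limsup (.of_forall fun n => ?_)
  exact mul_le_mul_right (le_envelope a _) _

/-- For the integrability of `2 ^ dLimsup` only the bound of the sums of `a` over prefix-free sets
matters. -/
theorem integrable_exp2_dLimsup (μ : Measure Cantor) [IsFiniteMeasure μ] {a : List Bool → ℝ}
    (ha : ∀ S, PrefixFree S → ∑' x : S, ENNReal.ofReal (a x) ≤ 1) :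
    Integrable (fun ω => exp2 (dLimsup a μ ω)) μ := by
  have h : (fun ω => exp2 (dLimsup a μ ω)) =
      fun ω => limsup (fun n => ratio (fun x => ENNReal.ofReal (a x)) μ n ω) atTop :=
    funext (exp2_dLimsup a μ)
  rw [h]
  refine ⟨(Measurable.limsup fun n => measurable_ratio n).aestronglyMeasurable, ?_⟩
  rw [hasFiniteIntegral_iff_enorm]
  exact (lintegral_limsup_ratio_le_one μ ha).trans_lt ENNReal.one_lt_top

/-! ### The a priori probability -/

/-- The sequence of outputs of a program is determined up to the last accepted input. -/
lemma Accepted.val_le {c : Nat.Partrec.Code} {s t : ℕ} {b b' : BasicCode} (hst : s ≤ t)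
    (h : Accepted c s b) (h' : Accepted c t b') (x : List Bool) : b.val x ≤ b'.val x := by
  obtain ⟨F, hF, -, -, rfl⟩ := h
  obtain ⟨G, hG, hmono, -, rfl⟩ := h'
  -- Both are decoded from the value of the same program at input `s`, so `G` alone links the times
  -- `s` and `t`.
  have hFG : F s = G s :=
    Encodable.encode_injective (Part.mem_unique (hF s le_rfl) (hG s hst))
  rw [hFG]
  clear hFG hF hG
  induction t, hst using Nat.le_induction with
  | base => exact le_rfl
  | succ t hst ih =>
    exact le_trans (ih fun n hn => hmono n (hn.trans t.lt_succ_self)) (hmono t t.lt_succ_self x)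

lemma Accepted.tsum_le_one {c : Nat.Partrec.Code} {t : ℕ} {b : BasicCode} (h : Accepted c t b)
    {S : Set (List Bool)} (hS : PrefixFree S) :
    ∑' x : S, ENNReal.ofReal (b.val x : ℝ) ≤ 1 := by
  obtain ⟨F, -, -, hF, rfl⟩ := h
  exact hF t le_rfl S hS

lemma enumSemimeasure_eq_iSup (c : Nat.Partrec.Code) (x : List Bool) :
    enumSemimeasure c x =
      ⨆ p : {p : ℕ × BasicCode // Accepted c p.1 p.2}, ENNReal.ofReal (p.1.2.val x : ℝ) := by
  rw [enumSemimeasure, iSup_subtype, iSup_prod]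

/-- The accepted approximations increase with time, so they are directed and the supremum commutes
with finite sums; each approximation obeys the bound by acceptance. -/
lemma tsum_enumSemimeasure_le_one (c : Nat.Partrec.Code) {S : Set (List Bool)}
    (hS : PrefixFree S) : ∑' x : S, enumSemimeasure c x ≤ 1 := by
  simp only [enumSemimeasure_eq_iSup]
  rw [ENNReal.tsum_eq_iSup_sum]
  refine iSup_le fun s => ?_
  rw [ENNReal.finsetSum_iSup]
  · exact iSup_le fun p => (ENNReal.sum_le_tsum s).trans (p.2.tsum_le_one hS)
  · intro p q
    rcases le_total p.1.1 q.1.1 with h | h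
    · exact ⟨q, fun x => ⟨ENNReal.ofReal_le_ofReal (by exact_mod_cast p.2.val_le h q.2 x), le_rfl⟩⟩
    · exact ⟨p, fun x => ⟨le_rfl, ENNReal.ofReal_le_ofReal (by exact_mod_cast q.2.val_le h p.2 x)⟩⟩

/-- The weights sum to 1, so the bound passes to the mixture after exchanging the two sums. The
`toReal` in `aPriori` can only decrease values. -/
lemma tsum_aPriori_le_one {S : Set (List Bool)} (hS : PrefixFree S) :
    ∑' x : S, ENNReal.ofReal (aPriori x) ≤ 1 := by
  calc
    _ ≤ ∑' x : S, ∑' j : ℕ, (2⁻¹ : ℝ≥0∞) ^ (j + 1) *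
          enumSemimeasure (Denumerable.ofNat Nat.Partrec.Code j) x :=
      ENNReal.tsum_le_tsum fun x => ENNReal.ofReal_toReal_le
    _ = ∑' j : ℕ, (2⁻¹ : ℝ≥0∞) ^ (j + 1) *
          ∑' x : S, enumSemimeasure (Denumerable.ofNat Nat.Partrec.Code j) x := by
      rw [ENNReal.tsum_comm]
      simp only [ENNReal.tsum_mul_left]
    _ ≤ ∑' j : ℕ, (2⁻¹ : ℝ≥0∞) ^ (j + 1) :=
      ENNReal.tsum_le_tsum fun j => mul_le_of_le_one_right' (tsum_enumSemimeasure_le_one _ hS)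
    _ = 1 := by
      rw [ENNReal.tsum_geometric_add_one, ENNReal.one_sub_inv_two, inv_inv]
      exact ENNReal.inv_mul_cancel two_ne_zero ENNReal.ofNat_ne_top

end Deficiency

open Deficiency in
theorem mainTheorem5 (μ : Measure Cantor) [IsFiniteMeasure μ] (hμ : IsComputableMeasure μ) :
    Integrable (fun ω => exp2 (dLimsup aPriori μ ω)) μ ∧
    ∀ a : List Bool → ℝ, IsMaximalSemimeasure a →
      Integrable (fun ω => exp2 (dLimsup a μ ω)) μ :=
  ⟨integrable_exp2_dLimsup μ fun _ => tsum_aPriori_le_one,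
    fun _ ha => integrable_exp2_dLimsup μ ha.1.sum_le_one⟩
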